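/- For an integer partition $\pi$ let $|\pi|$ be the sum of its parts, $l(\pi)$ its largest part ($0$ if $\pi$ is empty), $\#(\pi)$ its number of parts, and $\mathrm{rank}(\pi)=l(\pi)-\#(\pi)$; the size of the Durfee square of $\pi$ is the largest $d$ such that $\pi$ has at least $d$ parts that are $\ge d$. Fix an integer $N\ge 1$. For $1\le j\le N$, $m\in\mathbb{Z}$ and $n\ge 1$ put $$N_{S_1}(m,n;j):=\sum_{(\pi_1,\pi_2)}(-1)^{\#(\pi_1)},\qquad N_{S_1}(m,n):=\sum_{j=1}^{N}N_{S_1}(m,n;j),$$ where the first sum is over all pairs of partitions with $|\pi_1|+|\pi_2|=n$ such that $\pi_1$ is a (possibly empty) partition into distinct parts lying in $[N-j+1,N]$, the Durfee square of $\pi_2$ has size $j$, and $\mathrm{rank}(\pi_2)=m$. Put $$M_{S_2}(m,n):=\sum_{(\pi_1,\pi_2,\pi_3)}(-1)^{\#(\pi_1)},$$ where the sum is over all triples of (possibly empty) partitions with $|\pi_1|+|\pi_2|+|\pi_3|=n$ such that $\pi_1$ has distinct parts, $l(\pi_1),l(\pi_2),l(\pi_3)\le N$, and $\#(\pi_2)-\#(\pi_3)=m$.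 Define the finite second rank and crank moments by $$N_{2,N}(n):=\sum_{m=-\infty}^{\infty}m^2N_{S_1}(m,n),\qquad M_{2,N}(n):=\sum_{m=-\infty}^{\infty}m^2M_{S_2}(m,n).$$ Then, for every integer $N\ge 1$ and every integer $n\ge 1$, $$M_{2,N}(n)>N_{2,N}(n).$$ -/

import Mathlib

namespace FiniteMoments

/-- The largest part `l(π)` of a partition (`0` for the empty partition). -/
def largestPart {n : ℕ} (π : n.Partition) : ℕ := π.parts.sup

/-- The number of parts `#(π)` of a partition. -/
def numParts {n : ℕ} (π : n.Partition) : ℕ := Multiset.card π.parts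

/-- Dyson's rank of a partition: largest part minus number of parts. -/
def rank {n : ℕ} (π : n.Partition) : ℤ := (largestPart π : ℤ) - (numParts π : ℤ)

/-- The size of the Durfee square of a partition: the largest `d` such that
at least `d` parts are at least `d` (necessarily `d` is at most the number of parts). -/
def durfee {n : ℕ} (π : n.Partition) : ℕ :=
  Nat.findGreatest (fun d => d ≤ Multiset.card (π.parts.filter (fun i => d ≤ i))) (numParts π)

/-- The pairs `(π₁, π₂)` of partitions with `|π₁| + |π₂| = n`, where `π₁` has distinct parts, all
lying in `[N - j + 1, N]` (possibly `π₁` is empty), and `π₂` has Durfee square of size `j`.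
Only used for `1 ≤ j ≤ N`. The two sizes `(|π₁|, |π₂|)` are recorded in the first component. -/
def rankVectors (N j n : ℕ) : Finset (Σ s : ℕ × ℕ, s.1.Partition × s.2.Partition) :=
  (Finset.HasAntidiagonal.antidiagonal n).sigma fun s =>
    ((Nat.Partition.distincts s.1).filter fun π₁ => ∀ i ∈ π₁.parts, N - j + 1 ≤ i ∧ i ≤ N) ×ˢ
      (Finset.univ.filter fun π₂ : s.2.Partition => durfee π₂ = j)

/-- `N_{S₁}(m, n; j)`: the pairs `(π₁, π₂)` of total size `n`, with Durfee square of `π₂` of size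
`j` and `rank π₂ = m`, counted with weight `(-1) ^ #(π₁)`. -/
def rankCountDurfee (N j : ℕ) (m : ℤ) (n : ℕ) : ℤ :=
  ∑ v ∈ (rankVectors N j n).filter (fun v => rank v.2.2 = m), (-1) ^ numParts v.2.1

/-- `N_{S₁}(m, n)`: the sum of `N_{S₁}(m, n; j)` over `1 ≤ j ≤ N`. -/
def rankCount (N : ℕ) (m : ℤ) (n : ℕ) : ℤ :=
  ∑ j ∈ Finset.Icc 1 N, rankCountDurfee N j m n

/-- The triples `(π₁, (π₂, π₃))` of partitions with `|π₁| + (|π₂| + |π₃|) = n`, where `π₁` has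
distinct parts and the largest parts of `π₁`, `π₂`, `π₃` are all at most `N`. -/
def crankVectors (N n : ℕ) :
    Finset (Σ s : ℕ × ℕ, s.1.Partition × (Σ t : ℕ × ℕ, t.1.Partition × t.2.Partition)) :=
  (Finset.HasAntidiagonal.antidiagonal n).sigma fun s =>
    ((Nat.Partition.distincts s.1).filter fun π₁ => largestPart π₁ ≤ N) ×ˢ
      ((Finset.HasAntidiagonal.antidiagonal s.2).sigma fun t =>
        (Finset.univ.filter fun π₂ : t.1.Partition => largestPart π₂ ≤ N) ×ˢ
          (Finset.univ.filter fun π₃ : t.2.Partition => largestPart π₃ ≤ N))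

/-- `M_{S₂}(m, n)`: the triples of total size `n` with crank `#(π₂) - #(π₃) = m`, counted with
weight `(-1) ^ #(π₁)`. -/
def crankCount (N : ℕ) (m : ℤ) (n : ℕ) : ℤ :=
  ∑ v ∈ (crankVectors N n).filter
      (fun v => (numParts v.2.2.2.1 : ℤ) - (numParts v.2.2.2.2 : ℤ) = m),
    (-1) ^ numParts v.2.1

/-- There are finitely many ranks `m` for given `n`, so the rank moment below is a finite sum. -/
theorem finite_support_rankCount (N n : ℕ) :
    (Function.support fun m : ℤ => rankCount N m n).Finite := by
  refine Set.Finite.subset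
    (Finset.finite_toSet ((Finset.Icc 1 N).biUnion fun j =>
      (rankVectors N j n).image fun v => rank v.2.2)) ?_
  intro m hm
  obtain ⟨j, hj, hjm⟩ := Finset.exists_ne_zero_of_sum_ne_zero hm
  obtain ⟨v, hv, -⟩ := Finset.exists_ne_zero_of_sum_ne_zero hjm
  rw [Finset.mem_filter] at hv
  exact Finset.mem_coe.2 (Finset.mem_biUnion.2 ⟨j, hj, Finset.mem_image.2 ⟨v, hv.1, hv.2⟩⟩)

/-- There are finitely many cranks `m` for given `n`, so the crank moment below is a finite sum. -/
theorem finite_support_crankCount (N n : ℕ) :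
    (Function.support fun m : ℤ => crankCount N m n).Finite := by
  refine Set.Finite.subset (Finset.finite_toSet ((crankVectors N n).image
    fun v => (numParts v.2.2.2.1 : ℤ) - (numParts v.2.2.2.2 : ℤ))) ?_
  intro m hm
  obtain ⟨v, hv, -⟩ := Finset.exists_ne_zero_of_sum_ne_zero hm
  rw [Finset.mem_filter] at hv
  exact Finset.mem_coe.2 (Finset.mem_image.2 ⟨v, hv.1, hv.2⟩)

/-- The finite `k`-th rank moment `N_{k,N}(n) = ∑_{m ∈ ℤ} m ^ k N_{S₁}(m, n)`. -/
noncomputable def rankMoment (k N n : ℕ) : ℤ := ∑ᶠ m : ℤ, m ^ k * rankCount N m n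

/-- The finite `k`-th crank moment `M_{k,N}(n) = ∑_{m ∈ ℤ} m ^ k M_{S₂}(m, n)`. -/
noncomputable def crankMoment (k N n : ℕ) : ℤ := ∑ᶠ m : ℤ, m ^ k * crankCount N m n

end FiniteMoments

/-! Write (q)_j for (1 - q)⋯(1 - q^j) and D_j = ∑_{k ≤ j} q^k / (1 - q^k)^2. Both moments have
generating functions built from D_j.

Among partitions into parts at most j, the multiplicities are independent geometric variables, so
the number of parts has variance D_j (`variance_eq`). The difference of two independent copies has
second moment 2 D_j. Hence the crank moment has series (q)_N · 2 D_N / (q)_N^2 = 2 D_N / (q)_N.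

Removing the Durfee square of side j leaves a partition with at most j parts and one with parts at
most j. The rank is the largest part of the first minus the number of parts of the second, again a
difference of two variables with the same moments. The signed partitions turn one factor 1/(q)_j
into a Gaussian binomial (`signedSeries_mul_qFactorialInv`), so the rank moment has series 2 ∑_j [N,
j] q^(j^2) D_j / (q)_j.

By `sum_gaussBinom_mul_qFactorialInv`, 1/(q)_N = ∑_j [N, j] q^(j^2) / (q)_j. The difference of the
two series is therefore 2 ∑_j [N, j] q^(j^2) (D_N - D_j) / (q)_j. Every term has nonnegative
coefficients, and the term j = 0 is 2 D_N, whose coefficients are positive from degree 1 on. -/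

namespace FiniteMoments

open PowerSeries

/-! ### Nonnegative power series and Gaussian binomials -/

/-- All coefficients of the series are nonnegative. -/
def CoeffNonneg (f : ℤ⟦X⟧) : Prop := ∀ n, 0 ≤ coeff n f

theorem CoeffNonneg.add {f g : ℤ⟦X⟧} (hf : CoeffNonneg f) (hg : CoeffNonneg g) :
    CoeffNonneg (f + g) := fun n => by
  rw [map_add]; exact add_nonneg (hf n) (hg n)

theorem CoeffNonneg.mul {f g : ℤ⟦X⟧} (hf : CoeffNonneg f) (hg : CoeffNonneg g) :
    CoeffNonneg (f * g) := fun n => by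
  rw [coeff_mul]; exact Finset.sum_nonneg fun p _ => mul_nonneg (hf _) (hg _)

theorem coeffNonneg_one : CoeffNonneg 1 := fun n => by
  rw [coeff_one]; split_ifs <;> norm_num

theorem coeffNonneg_X_pow (k : ℕ) : CoeffNonneg (X ^ k) := fun n => by
  rw [coeff_X_pow]; split_ifs <;> norm_num

theorem CoeffNonneg.sum {ι : Type*} {s : Finset ι} {f : ι → ℤ⟦X⟧}
    (h : ∀ i ∈ s, CoeffNonneg (f i)) : CoeffNonneg (∑ i ∈ s, f i) := fun n => by
  rw [map_sum]; exact Finset.sum_nonneg fun i hi => h i hi n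

/-- The geometric series `1 / (1 - X ^ k)`, for `0 < k`. -/
noncomputable def geomSeries (k : ℕ) : ℤ⟦X⟧ := PowerSeries.mk fun n => if k ∣ n then 1 else 0

theorem coeffNonneg_geomSeries (k : ℕ) : CoeffNonneg (geomSeries k) := fun n => by
  rw [geomSeries, coeff_mk]; split_ifs <;> norm_num

theorem one_sub_X_pow_mul_geomSeries {k : ℕ} (hk : 0 < k) :
    (1 - X ^ k) * geomSeries k = 1 := by
  ext n
  rw [sub_mul, one_mul, map_sub, coeff_X_pow_mul', coeff_one, geomSeries, coeff_mk, coeff_mk]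
  rcases lt_or_ge n k with h | h
  · rcases Nat.eq_zero_or_pos n with rfl | hn
    · simp [hk.ne']
    · simp [h.not_ge, hn.ne', Nat.not_dvd_of_pos_of_lt hn h]
  · have hd : k ∣ n - k ↔ k ∣ n := by
      rw [← Nat.dvd_add_left (dvd_refl k), Nat.sub_add_cancel h]
    simp [h, hd, (hk.trans_le h).ne']

/-- The finite product `(q; q)_n`. -/
noncomputable def qFactorial (n : ℕ) : ℤ⟦X⟧ := ∏ k ∈ Finset.range n, (1 - X ^ (k + 1))

/-- The reciprocal of `(q; q)_n`. -/
noncomputable def qFactorialInv (n : ℕ) : ℤ⟦X⟧ := ∏ k ∈ Finset.range n, geomSeries (k + 1)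

theorem qFactorial_mul_inv (n : ℕ) : qFactorial n * qFactorialInv n = 1 := by
  rw [qFactorial, qFactorialInv, ← Finset.prod_mul_distrib]
  exact Finset.prod_eq_one fun k _ => one_sub_X_pow_mul_geomSeries k.succ_pos

theorem qFactorial_succ (n : ℕ) : qFactorial (n + 1) = qFactorial n * (1 - X ^ (n + 1)) :=
  Finset.prod_range_succ _ _

theorem qFactorialInv_succ (n : ℕ) :
    qFactorialInv (n + 1) = qFactorialInv n * geomSeries (n + 1) :=
  Finset.prod_range_succ _ _

theorem qFactorialInv_succ_mul (n : ℕ) :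
    qFactorialInv (n + 1) * (1 - X ^ (n + 1)) = qFactorialInv n := by
  linear_combination (1 - X ^ (n + 1)) * qFactorialInv_succ n +
    qFactorialInv n * one_sub_X_pow_mul_geomSeries (Nat.add_one_pos n)

theorem coeffNonneg_qFactorialInv (n : ℕ) : CoeffNonneg (qFactorialInv n) := by
  induction n with
  | zero => simpa [qFactorialInv] using coeffNonneg_one
  | succ n ih => rw [qFactorialInv_succ]; exact ih.mul (coeffNonneg_geomSeries _)

/-- The Gaussian binomial coefficient. -/
noncomputable def gaussBinom : ℕ → ℕ → ℤ⟦X⟧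
  | _, 0 => 1
  | 0, _ + 1 => 0
  | n + 1, k + 1 => X ^ (k + 1) * gaussBinom n (k + 1) + gaussBinom n k

theorem gaussBinom_zero_right (n : ℕ) : gaussBinom n 0 = 1 := by
  cases n <;> simp [gaussBinom]

theorem gaussBinom_succ_succ (n k : ℕ) :
    gaussBinom (n + 1) (k + 1) = X ^ (k + 1) * gaussBinom n (k + 1) + gaussBinom n k := by
  simp [gaussBinom]

theorem coeffNonneg_gaussBinom (n k : ℕ) : CoeffNonneg (gaussBinom n k) := by
  induction n generalizing k with
  | zero =>
    cases k with
    | zero => rw [gaussBinom_zero_right]; exact coeffNonneg_one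
    | succ k => intro n; simp [gaussBinom]
  | succ n ih =>
    cases k with
    | zero => rw [gaussBinom_zero_right]; exact coeffNonneg_one
    | succ k =>
      rw [gaussBinom_succ_succ]
      exact ((coeffNonneg_X_pow _).mul (ih _)).add (ih _)

theorem gaussBinom_eq_zero_of_lt {n k : ℕ} (h : n < k) : gaussBinom n k = 0 := by
  induction n generalizing k with
  | zero => obtain ⟨k, rfl⟩ := Nat.exists_eq_succ_of_ne_zero h.ne'; simp [gaussBinom]
  | succ n ih =>
    obtain ⟨k, rfl⟩ := Nat.exists_eq_succ_of_ne_zero (Nat.ne_zero_of_lt h)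
    rw [Nat.succ_eq_add_one, gaussBinom_succ_succ, ih (by omega), ih (by omega)]
    simp

theorem gaussBinom_self (n : ℕ) : gaussBinom n n = 1 := by
  induction n with
  | zero => exact gaussBinom_zero_right 0
  | succ n ih => rw [gaussBinom_succ_succ, ih, gaussBinom_eq_zero_of_lt n.lt_succ_self]; simp

/-- The quotient formula without division. The induction step rests on 1 - q^(i+j+2) = q^(j+1) (1 -
q^(i+1)) + (1 - q^(j+1)). -/
theorem gaussBinom_mul_qFactorial (i j : ℕ) :
    gaussBinom (i + j) j * (qFactorial i * qFactorial j) = qFactorial (i + j) := by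
  induction i generalizing j with
  | zero => simp [gaussBinom_self, qFactorial]
  | succ i ihi =>
    induction j with
    | zero => simp [gaussBinom_zero_right, qFactorial]
    | succ j ihj =>
      have h1 := ihi (j + 1)
      rw [show i + (j + 1) = i + 1 + j by ring] at h1
      rw [← add_assoc, gaussBinom_succ_succ, qFactorial_succ (i + 1 + j)]
      have h2 := qFactorial_succ i
      have h3 := qFactorial_succ j
      linear_combination X ^ (j + 1) * (1 - X ^ (i + 1)) * h1 + (1 - X ^ (j + 1)) * ihj
        + X ^ (j + 1) * gaussBinom (i + 1 + j) (j + 1) * qFactorial (j + 1) * h2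
        + gaussBinom (i + 1 + j) j * qFactorial (i + 1) * h3

/-- The `q`-Chu–Vandermonde sum behind the Durfee rectangle dissection. -/
theorem sum_gaussBinom_mul_qFactorialInv (n a : ℕ) :
    ∑ j ∈ Finset.range (n + 1), gaussBinom n j * X ^ (j * j + a * j) * qFactorialInv (j + a) =
      qFactorialInv (n + a) := by
  induction n generalizing a with
  | zero => simp [gaussBinom_zero_right]
  | succ n ih =>
    -- Substituting 1/(q)_{j+a} = (1 - q^(j+a+1)) / (q)_{j+a+1} splits the summand for (n, a + 1)
    -- into two pieces. They are the two halves of the Pascal rule for n + 1, the second with its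
    -- index shifted by one.
    have key : ∀ j, gaussBinom n j * X ^ (j * j + (a + 1) * j) * qFactorialInv (j + (a + 1)) =
        X ^ j * gaussBinom n j * X ^ (j * j + a * j) * qFactorialInv (j + a) +
        gaussBinom n j * X ^ ((j + 1) * (j + 1) + a * (j + 1)) * qFactorialInv (j + 1 + a) := by
      intro j
      rw [show j + (a + 1) = j + a + 1 by ring, show j + 1 + a = j + a + 1 by ring,
        ← qFactorialInv_succ_mul (j + a)]
      ring
    rw [show n + 1 + a = n + (a + 1) by ring, ← ih (a + 1), Finset.sum_congr rfl fun j _ => key j,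
      Finset.sum_add_distrib, Finset.sum_range_succ']
    simp only [gaussBinom_succ_succ, add_mul, Finset.sum_add_distrib]
    rw [add_right_comm]
    congr 1
    rw [Finset.sum_range_succ]
    conv_rhs => rw [Finset.sum_range_succ']
    rw [gaussBinom_eq_zero_of_lt n.lt_succ_self]
    simp [gaussBinom_zero_right, add_mul]

/-- The series `∑_{k ≤ n} q ^ k / (1 - q ^ k) ^ 2`. -/
noncomputable def divisorSeries (n : ℕ) : ℤ⟦X⟧ :=
  ∑ k ∈ Finset.range n, X ^ (k + 1) * geomSeries (k + 1) ^ 2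

theorem divisorSeries_succ (n : ℕ) : divisorSeries (n + 1) =
    divisorSeries n + X ^ (n + 1) * geomSeries (n + 1) ^ 2 :=
  Finset.sum_range_succ _ _

theorem coeffNonneg_divisorSeries_sub {m n : ℕ} (h : m ≤ n) :
    CoeffNonneg (divisorSeries n - divisorSeries m) := by
  rw [divisorSeries, divisorSeries, Finset.sum_range_sub_sum_range h]
  refine CoeffNonneg.sum fun k _ => (coeffNonneg_X_pow _).mul ?_
  rw [sq]
  exact (coeffNonneg_geomSeries _).mul (coeffNonneg_geomSeries _)

/-- The term k = 1 alone suffices: q / (1 - q)^2 has coefficient n at q^n. -/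
theorem coeff_divisorSeries_pos {N n : ℕ} (hN : 1 ≤ N) (hn : 1 ≤ n) :
    0 < coeff n (divisorSeries N) := by
  have h := coeffNonneg_divisorSeries_sub hN n
  rw [map_sub, sub_nonneg] at h
  refine lt_of_lt_of_le ?_ h
  obtain ⟨n, rfl⟩ := Nat.exists_eq_succ_of_ne_zero (Nat.ne_zero_of_lt hn)
  rw [divisorSeries, Finset.sum_range_one, zero_add, pow_one, Nat.succ_eq_add_one,
    coeff_succ_X_mul, sq, coeff_mul]
  simp only [geomSeries, coeff_mk, one_dvd, if_true, mul_one, Finset.sum_const,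
    Finset.Nat.card_antidiagonal]
  rw [nsmul_eq_mul, mul_one]
  positivity

/-- Expanding 1/(q)_N by the Vandermonde sum lets the two sides be compared term by term, through
D_j ≤ D_N; strictness comes from j = 0, where D_0 = 0. -/
theorem coeff_rank_lt_crank {N n : ℕ} (hN : 1 ≤ N) (hn : 1 ≤ n) :
    coeff n (∑ j ∈ Finset.range (N + 1),
      gaussBinom N j * X ^ (j * j) * qFactorialInv j * divisorSeries j) <
    coeff n (qFactorialInv N * divisorSeries N) := by
  have h := sum_gaussBinom_mul_qFactorialInv N 0
  simp only [zero_mul, add_zero] at h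
  rw [← sub_pos, ← map_sub, ← h, Finset.sum_mul, ← Finset.sum_sub_distrib,
    Finset.sum_range_succ', map_add]
  refine add_pos_of_nonneg_of_pos ?_ ?_
  · refine CoeffNonneg.sum (fun j hj => ?_) n
    rw [← mul_sub]
    refine CoeffNonneg.mul ?_ (coeffNonneg_divisorSeries_sub (by
      have := Finset.mem_range.1 hj; omega))
    exact ((coeffNonneg_gaussBinom _ _).mul (coeffNonneg_X_pow _)).mul
      (coeffNonneg_qFactorialInv _)
  · simpa [gaussBinom_zero_right, qFactorialInv, divisorSeries] using
      coeff_divisorSeries_pos hN hn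

/-! ### Generating series of weighted partitions -/

/-- The multisets of positive integers with sum `n`. -/
def partsFinset (n : ℕ) : Finset (Multiset ℕ) :=
  (Finset.univ : Finset n.Partition).image Nat.Partition.parts

theorem mem_partsFinset {n : ℕ} {m : Multiset ℕ} :
    m ∈ partsFinset n ↔ m.sum = n ∧ ∀ i ∈ m, 0 < i := by
  constructor
  · intro h
    obtain ⟨π, -, rfl⟩ := Finset.mem_image.1 h
    exact ⟨π.parts_sum, fun i hi => π.parts_pos hi⟩
  · rintro ⟨h, hp⟩
    exact Finset.mem_image.2 ⟨⟨m, fun {i} hi => hp i hi, h⟩, Finset.mem_univ _, rfl⟩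

/-- Plain multisets let bijections change the size without transport in a dependent type. -/
theorem sum_partition_eq {n : ℕ} (w : Multiset ℕ → ℤ) :
    ∑ π : n.Partition, w π.parts = ∑ m ∈ partsFinset n, w m := by
  rw [partsFinset, Finset.sum_image]
  intro π _ π' _ h
  exact Nat.Partition.ext h

/-- The generating series of partitions, weighted by a function of the multiset of parts. -/
noncomputable def genSeries (w : Multiset ℕ → ℤ) : ℤ⟦X⟧ :=
  PowerSeries.mk fun n => ∑ m ∈ partsFinset n, w m

theorem genSeries_add (v w : Multiset ℕ → ℤ) :
    genSeries (fun m => v m + w m) = genSeries v + genSeries w := by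
  ext n
  simp [genSeries, Finset.sum_add_distrib]

theorem genSeries_neg (w : Multiset ℕ → ℤ) :
    genSeries (fun m => -w m) = -genSeries w := by
  ext n
  simp [genSeries, Finset.sum_neg_distrib]

/-- A bijection which lowers the size by `k` multiplies the generating series by `X ^ k`. -/
theorem genSeries_eq_X_pow_mul (k : ℕ) (p q : Multiset ℕ → Prop) [DecidablePred p]
    [DecidablePred q] (e e' : Multiset ℕ → Multiset ℕ)
    (he : ∀ m, (∀ i ∈ m, 0 < i) → p m →
      q (e m) ∧ (∀ i ∈ e m, 0 < i) ∧ (e m).sum + k = m.sum ∧ e' (e m) = m)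
    (he' : ∀ m, (∀ i ∈ m, 0 < i) → q m →
      p (e' m) ∧ (∀ i ∈ e' m, 0 < i) ∧ (e' m).sum = m.sum + k ∧ e (e' m) = m)
    (w : Multiset ℕ → ℤ) :
    genSeries (fun m => if p m then w m else 0) =
      X ^ k * genSeries (fun m => if q m then w (e' m) else 0) := by
  ext n
  rw [coeff_X_pow_mul', genSeries, genSeries, coeff_mk, coeff_mk, ← Finset.sum_filter,
    ← Finset.sum_filter]
  split_ifs with h
  · refine Finset.sum_bij' (fun m _ => e m) (fun m _ => e' m) ?_ ?_ ?_ ?_ ?_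
    · intro m hm
      simp only [Finset.mem_filter, mem_partsFinset] at hm ⊢
      obtain ⟨h1, h2, h3, -⟩ := he m hm.1.2 hm.2
      exact ⟨⟨by omega, h2⟩, h1⟩
    · intro m hm
      simp only [Finset.mem_filter, mem_partsFinset] at hm ⊢
      obtain ⟨h1, h2, h3, -⟩ := he' m hm.1.2 hm.2
      exact ⟨⟨by omega, h2⟩, h1⟩
    · intro m hm
      simp only [Finset.mem_filter, mem_partsFinset] at hm
      exact (he m hm.1.2 hm.2).2.2.2
    · intro m hm
      simp only [Finset.mem_filter, mem_partsFinset] at hm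
      exact (he' m hm.1.2 hm.2).2.2.2
    · intro m hm
      simp only [Finset.mem_filter, mem_partsFinset] at hm
      rw [(he m hm.1.2 hm.2).2.2.2]
  · refine Finset.sum_eq_zero fun m hm => ?_
    simp only [Finset.mem_filter, mem_partsFinset] at hm
    have := (he m hm.1.2 hm.2).2.2.1
    omega

/-! ### Raising all parts -/

/-- Pad a multiset with zeros to `k` elements and add `c` to each of them. -/
def raise (c k : ℕ) (a : Multiset ℕ) : Multiset ℕ :=
  a.map (· + c) + Multiset.replicate (k - Multiset.card a) c

/-- Subtract `c` from each element and discard what does not stay positive. -/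
def lower (c : ℕ) (m : Multiset ℕ) : Multiset ℕ :=
  (m.filter (c < ·)).map (· - c)

theorem card_raise {c k : ℕ} {a : Multiset ℕ} (h : Multiset.card a ≤ k) :
    Multiset.card (raise c k a) = k := by
  simp [raise, h]

theorem sum_raise {c k : ℕ} {a : Multiset ℕ} (h : Multiset.card a ≤ k) :
    (raise c k a).sum = a.sum + k * c := by
  rw [raise, Multiset.sum_add, Multiset.sum_map_add]
  simp only [Multiset.map_id', Multiset.map_const', Multiset.sum_replicate, smul_eq_mul]
  rw [add_assoc, ← add_mul, Nat.add_sub_cancel' h]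

theorem le_of_mem_raise {c k i : ℕ} {a : Multiset ℕ} (h : i ∈ raise c k a) : c ≤ i := by
  rw [raise, Multiset.mem_add, Multiset.mem_map] at h
  rcases h with ⟨x, -, rfl⟩ | h
  · omega
  · exact (Multiset.eq_of_mem_replicate h).ge

theorem sup_raise {c k : ℕ} (hk : 0 < k) {a : Multiset ℕ} (h : Multiset.card a ≤ k) :
    (raise c k a).sup = a.sup + c := by
  apply le_antisymm
  · refine Multiset.sup_le.2 fun i hi => ?_
    rw [raise, Multiset.mem_add, Multiset.mem_map] at hi
    rcases hi with ⟨x, hx, rfl⟩ | hi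
    · exact Nat.add_le_add_right (Multiset.le_sup hx) c
    · rw [Multiset.eq_of_mem_replicate hi]
      exact Nat.le_add_left _ _
  · have hc : c ≤ (raise c k a).sup := by
      obtain ⟨i, hi⟩ := Multiset.card_pos_iff_exists_mem.1 ((card_raise (c := c) h).symm ▸ hk)
      exact (le_of_mem_raise hi).trans (Multiset.le_sup hi)
    have ha : a.sup ≤ (raise c k a).sup - c := by
      refine Multiset.sup_le.2 fun x hx => ?_
      have : x + c ∈ raise c k a :=
        Multiset.mem_add.2 (Or.inl (Multiset.mem_map.2 ⟨x, hx, rfl⟩))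
      have := Multiset.le_sup this
      omega
    omega

theorem filter_lt_raise {c k : ℕ} {a : Multiset ℕ} (ha : ∀ i ∈ a, 0 < i) :
    (raise c k a).filter (c < ·) = a.map (· + c) := by
  rw [raise, Multiset.filter_add, Multiset.filter_eq_self.2, Multiset.filter_eq_nil.2, add_zero]
  · intro i hi
    rw [Multiset.eq_of_mem_replicate hi]
    exact lt_irrefl c
  · intro i hi
    obtain ⟨x, hx, rfl⟩ := Multiset.mem_map.1 hi
    have := ha x hx
    omega

theorem filter_not_lt_raise {c k : ℕ} {a : Multiset ℕ} (ha : ∀ i ∈ a, 0 < i) :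
    (raise c k a).filter (¬ c < ·) = Multiset.replicate (k - Multiset.card a) c := by
  rw [raise, Multiset.filter_add, Multiset.filter_eq_nil.2, Multiset.filter_eq_self.2, zero_add]
  · intro i hi
    rw [Multiset.eq_of_mem_replicate hi]
    exact lt_irrefl c
  · intro i hi
    obtain ⟨x, hx, rfl⟩ := Multiset.mem_map.1 hi
    have := ha x hx
    omega

theorem lower_raise {c k : ℕ} {a : Multiset ℕ} (ha : ∀ i ∈ a, 0 < i) :
    lower c (raise c k a) = a := by
  rw [lower, filter_lt_raise ha]
  simp

theorem map_add_lower (c : ℕ) (m : Multiset ℕ) :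
    (lower c m).map (· + c) = m.filter (c < ·) := by
  rw [lower, Multiset.map_map]
  conv_rhs => rw [← Multiset.map_id (m.filter (c < ·))]
  refine Multiset.map_congr rfl fun i hi => ?_
  have := (Multiset.mem_filter.1 hi).2
  simp only [Function.comp_apply, id]
  omega

theorem card_lower (c : ℕ) (m : Multiset ℕ) :
    Multiset.card (lower c m) = Multiset.card (m.filter (c < ·)) :=
  Multiset.card_map _ _

theorem pos_of_mem_lower {c i : ℕ} {m : Multiset ℕ} (h : i ∈ lower c m) : 0 < i := by
  obtain ⟨x, hx, rfl⟩ := Multiset.mem_map.1 h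
  exact Nat.sub_pos_of_lt (Multiset.mem_filter.1 hx).2

/-- The elements equal to c are exactly those that `lower` drops and the padding restores. -/
theorem raise_lower {c : ℕ} {m : Multiset ℕ} (h : ∀ i ∈ m, c ≤ i) :
    raise c (Multiset.card m) (lower c m) = m := by
  have h1 : m.filter (¬ c < ·) =
      Multiset.replicate (Multiset.card m - Multiset.card (lower c m)) c := by
    rw [Multiset.eq_replicate]
    constructor
    · have := congrArg Multiset.card (Multiset.filter_add_not (c < ·) m)
      rw [Multiset.card_add] at this
      rw [card_lower]
      omega
    · intro i hi
      rw [Multiset.mem_filter] at hi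
      have := h i hi.1
      omega
  rw [raise, map_add_lower, ← h1, Multiset.filter_add_not]

/-! ### The two recursions -/

/-- Partitions into parts at most `j`, weighted by a function of the number of parts. -/
noncomputable def boundedSeries (j : ℕ) (f : ℕ → ℤ) : ℤ⟦X⟧ :=
  genSeries fun m => if ∀ i ∈ m, i ≤ j then f (Multiset.card m) else 0

/-- Partitions into at most `j` parts, weighted by a function of the largest part. -/
noncomputable def shortSeries (j : ℕ) (f : ℕ → ℤ) : ℤ⟦X⟧ :=
  genSeries fun m => if Multiset.card m ≤ j then f m.sup else 0

theorem genSeries_congr {v w : Multiset ℕ → ℤ} (h : ∀ m, (∀ i ∈ m, 0 < i) → v m = w m) :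
    genSeries v = genSeries w := by
  ext n
  rw [genSeries, genSeries, coeff_mk, coeff_mk]
  exact Finset.sum_congr rfl fun m hm => h m (mem_partsFinset.1 hm).2

theorem genSeries_eq_C {w : Multiset ℕ → ℤ} (h : ∀ m, (∀ i ∈ m, 0 < i) → m ≠ 0 → w m = 0) :
    genSeries w = C (w 0) := by
  ext n
  rw [genSeries, coeff_mk, coeff_C]
  split_ifs with hn
  · subst hn
    have h0 : (0 : Multiset ℕ) ∈ partsFinset 0 := by
      rw [mem_partsFinset]
      simp
    refine Finset.sum_eq_single_of_mem _ h0 fun m hm hm0 => ?_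
    exact h m (mem_partsFinset.1 hm).2 hm0
  · refine Finset.sum_eq_zero fun m hm => h m (mem_partsFinset.1 hm).2 ?_
    rintro rfl
    exact hn (mem_partsFinset.1 hm).1.symm

theorem boundedSeries_zero (f : ℕ → ℤ) : boundedSeries 0 f = C (f 0) := by
  rw [boundedSeries, genSeries_eq_C]
  · simp
  · intro m hm hm0
    obtain ⟨i, hi⟩ := Multiset.exists_mem_of_ne_zero hm0
    exact if_neg fun h => absurd (h i hi) (hm i hi).not_ge

theorem shortSeries_zero (f : ℕ → ℤ) : shortSeries 0 f = C (f 0) := by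
  rw [shortSeries, genSeries_eq_C]
  · simp
  · intro m _ hm0
    exact if_neg fun h => hm0 (Multiset.card_eq_zero.1 (Nat.le_zero.1 h))

/-- Either j + 1 is not a part, or one copy of it can be removed. -/
theorem boundedSeries_succ (j : ℕ) (f : ℕ → ℤ) :
    boundedSeries (j + 1) f =
      boundedSeries j f + X ^ (j + 1) * boundedSeries (j + 1) fun x => f (x + 1) := by
  have h := genSeries_eq_X_pow_mul (j + 1) (fun m => (∀ i ∈ m, i ≤ j + 1) ∧ j + 1 ∈ m)
    (fun m => ∀ i ∈ m, i ≤ j + 1) (fun m => m.erase (j + 1)) (fun m => (j + 1) ::ₘ m)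
    (fun m hm hp => ⟨fun i hi => hp.1 i (Multiset.mem_of_mem_erase hi),
      fun i hi => hm i (Multiset.mem_of_mem_erase hi),
      by rw [add_comm, Multiset.sum_erase hp.2], Multiset.cons_erase hp.2⟩)
    (fun m hm hq => ⟨⟨fun i hi => (Multiset.mem_cons.1 hi).elim (fun h => h.le) (hq i),
        Multiset.mem_cons_self _ _⟩,
      fun i hi => (Multiset.mem_cons.1 hi).elim (fun h => h ▸ j.succ_pos) (hm i),
      by rw [Multiset.sum_cons, add_comm], Multiset.erase_cons_head _ _⟩)
    (fun m => f (Multiset.card m))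
  simp only [Multiset.card_cons] at h
  rw [boundedSeries, boundedSeries, boundedSeries, ← h, ← genSeries_add]
  refine genSeries_congr fun m _ => ?_
  by_cases hj : j + 1 ∈ m
  · have : ¬ ∀ i ∈ m, i ≤ j := fun h => absurd (h _ hj) (by omega)
    simp [hj, this]
  · have : (∀ i ∈ m, i ≤ j + 1) ↔ ∀ i ∈ m, i ≤ j := by
      refine forall₂_congr fun i hi => ?_
      have : i ≠ j + 1 := fun h => hj (h ▸ hi)
      omega
    simp [hj, this]

/-- Either there are at most j parts, or exactly j + 1 and each can be lowered by 1. The recursion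
is that of `boundedSeries_succ`, which replaces any appeal to conjugation. -/
theorem shortSeries_succ (j : ℕ) (f : ℕ → ℤ) :
    shortSeries (j + 1) f =
      shortSeries j f + X ^ (j + 1) * shortSeries (j + 1) fun x => f (x + 1) := by
  have h := genSeries_eq_X_pow_mul (j + 1) (fun m => Multiset.card m = j + 1)
    (fun m => Multiset.card m ≤ j + 1) (lower 1) (raise 1 (j + 1))
    (fun m hm hp => by
      have h1 : Multiset.card (lower 1 m) ≤ j + 1 := by
        rw [card_lower, ← hp]; exact Multiset.card_le_card (Multiset.filter_le _ _)
      have h2 : raise 1 (j + 1) (lower 1 m) = m := by rw [← hp]; exact raise_lower hm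
      refine ⟨h1, fun i => pos_of_mem_lower, ?_, h2⟩
      have := sum_raise (c := 1) h1
      rw [h2] at this
      omega)
    (fun m hm hq => ⟨card_raise hq, fun i => le_of_mem_raise, by rw [sum_raise hq, mul_one],
      lower_raise hm⟩)
    (fun m => f m.sup)
  have h' : shortSeries (j + 1) (fun x => f (x + 1)) = genSeries fun m =>
      if Multiset.card m ≤ j + 1 then f (raise 1 (j + 1) m).sup else 0 := by
    refine genSeries_congr fun m _ => ?_
    split_ifs with hm
    · rw [sup_raise j.succ_pos hm]
    · rfl
  rw [h', ← h, shortSeries, shortSeries, ← genSeries_add]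
  refine genSeries_congr fun m _ => ?_
  rcases lt_trichotomy (Multiset.card m) (j + 1) with hm | hm | hm
  · simp [hm.le, hm.ne, Nat.lt_succ_iff.1 hm]
  · simp [hm]
  · simp [hm.not_ge, hm.ne', (Nat.lt_of_succ_lt hm).not_ge]

theorem boundedSeries_add (j : ℕ) (f g : ℕ → ℤ) :
    boundedSeries j (fun x => f x + g x) = boundedSeries j f + boundedSeries j g := by
  rw [boundedSeries, boundedSeries, boundedSeries, ← genSeries_add]
  exact genSeries_congr fun m _ => by split_ifs <;> simp

theorem shortSeries_add (j : ℕ) (f g : ℕ → ℤ) :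
    shortSeries j (fun x => f x + g x) = shortSeries j f + shortSeries j g := by
  rw [shortSeries, shortSeries, shortSeries, ← genSeries_add]
  exact genSeries_congr fun m _ => by split_ifs <;> simp

/-- The common properties of `boundedSeries` and `shortSeries` determine their moments. -/
structure IsPartSeries (F : ℕ → (ℕ → ℤ) → ℤ⟦X⟧) : Prop where
  zero : ∀ f, F 0 f = C (f 0)
  succ : ∀ j f, F (j + 1) f = F j f + X ^ (j + 1) * F (j + 1) fun x => f (x + 1)
  add : ∀ j f g, F j (fun x => f x + g x) = F j f + F j g

theorem isPartSeries_boundedSeries : IsPartSeries boundedSeries :=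
  ⟨boundedSeries_zero, boundedSeries_succ, boundedSeries_add⟩

theorem isPartSeries_shortSeries : IsPartSeries shortSeries :=
  ⟨shortSeries_zero, shortSeries_succ, shortSeries_add⟩

/-! ### Moments up to order two from the recursion -/

namespace IsPartSeries

variable {F G : ℕ → (ℕ → ℤ) → ℤ⟦X⟧}

theorem zeroth_succ (hF : IsPartSeries F) (j : ℕ) :
    F (j + 1) (fun _ => 1) = F j (fun _ => 1) + X ^ (j + 1) * F (j + 1) fun _ => 1 :=
  hF.succ j _

theorem first_succ (hF : IsPartSeries F) (j : ℕ) :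
    F (j + 1) (fun x => x) = F j (fun x => x) +
      X ^ (j + 1) * (F (j + 1) (fun x => x) + F (j + 1) fun _ => 1) := by
  rw [← hF.add]
  exact (hF.succ j _).trans (by simp only [Nat.cast_add, Nat.cast_one])

theorem second_succ (hF : IsPartSeries F) (j : ℕ) :
    F (j + 1) (fun x => (x : ℤ) ^ 2) = F j (fun x => (x : ℤ) ^ 2) +
      X ^ (j + 1) * (F (j + 1) (fun x => (x : ℤ) ^ 2) + F (j + 1) (fun x => x) +
        F (j + 1) (fun x => x) + F (j + 1) fun _ => 1) := by
  rw [← hF.add, ← hF.add, ← hF.add, hF.succ]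
  congr 3
  funext x
  push_cast
  ring

theorem zeroth_eq (hF : IsPartSeries F) (j : ℕ) : F j (fun _ => 1) = qFactorialInv j := by
  induction j with
  | zero => simp [hF.zero, qFactorialInv]
  | succ j ih =>
    have h := hF.zeroth_succ j
    rw [ih] at h
    rw [qFactorialInv_succ]
    linear_combination geomSeries (j + 1) * h -
      F (j + 1) (fun _ => 1) * one_sub_X_pow_mul_geomSeries (Nat.add_one_pos j)

/-- The recursion determines the first moment since 1 - q^(j+1) is invertible. No closed form is
needed: first moments cancel into the variance. -/
theorem first_eq (hF : IsPartSeries F) (hG : IsPartSeries G) (j : ℕ) :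
    F j (fun x => x) = G j (fun x => x) := by
  induction j with
  | zero => simp [hF.zero, hG.zero]
  | succ j ih =>
    have h := hF.first_succ j
    have h' := hG.first_succ j
    rw [hF.zeroth_eq] at h
    rw [hG.zeroth_eq] at h'
    linear_combination geomSeries (j + 1) * (h - h' + ih) -
      (F (j + 1) (fun x => x) - G (j + 1) (fun x => x)) *
        one_sub_X_pow_mul_geomSeries (Nat.add_one_pos j)

theorem second_eq (hF : IsPartSeries F) (hG : IsPartSeries G) (j : ℕ) :
    F j (fun x => (x : ℤ) ^ 2) = G j (fun x => (x : ℤ) ^ 2) := by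
  induction j with
  | zero => simp [hF.zero, hG.zero]
  | succ j ih =>
    have h := hF.second_succ j
    have h' := hG.second_succ j
    rw [hF.zeroth_eq, hF.first_eq hG] at h
    rw [hG.zeroth_eq] at h'
    linear_combination geomSeries (j + 1) * (h - h' + ih) -
      (F (j + 1) (fun x => (x : ℤ) ^ 2) - G (j + 1) (fun x => (x : ℤ) ^ 2)) *
        one_sub_X_pow_mul_geomSeries (Nat.add_one_pos j)

/-- The variance, cleared of denominators. Passing from j to j + 1 adds an independent geometric
variable of variance q^(j+1) / (1 - q^(j+1))^2. -/
theorem variance_eq (hF : IsPartSeries F) (j : ℕ) :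
    F j (fun x => (x : ℤ) ^ 2) * F j (fun _ => 1) - F j (fun x => x) ^ 2 =
      qFactorialInv j ^ 2 * divisorSeries j := by
  induction j with
  | zero => simp [hF.zero, divisorSeries]
  | succ j ih =>
    have h0 := hF.zeroth_succ j
    have h1 := hF.first_succ j
    have h2 := hF.second_succ j
    have hg := one_sub_X_pow_mul_geomSeries (Nat.add_one_pos j)
    have hP := hF.zeroth_eq j
    have hP' := hF.zeroth_eq (j + 1)
    have hq := qFactorialInv_succ j
    rw [divisorSeries_succ]
    generalize F (j + 1) (fun x => (x : ℤ) ^ 2) = c' at *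
    generalize F j (fun x => (x : ℤ) ^ 2) = c at *
    generalize F (j + 1) (fun x => (x : ℤ)) = b' at *
    generalize F j (fun x => (x : ℤ)) = b at *
    rw [hP] at ih h0
    rw [hP'] at h0 h1 h2 ⊢
    generalize qFactorialInv (j + 1) = a' at *
    generalize qFactorialInv j = a at *
    generalize geomSeries (j + 1) = g at *
    generalize (X : ℤ⟦X⟧) ^ (j + 1) = u at *
    -- Expressing level j through level j + 1 avoids inverses, so `key` is a polynomial identity;
    -- multiplying by g^2 then divides by (1 - u)^2.
    have e0 : a = (1 - u) * a' := by linear_combination -h0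
    have e1 : b = (1 - u) * b' - u * a' := by linear_combination -h1
    have e2 : c = (1 - u) * c' - u * (2 * b' + a') := by linear_combination -h2
    have key : (1 - u) ^ 2 * (c' * a' - b' ^ 2) = (c * a - b ^ 2) + u * a' ^ 2 := by
      rw [e0, e1, e2]; ring
    have hga : ((1 - u) * g) ^ 2 = 1 := by rw [hg, one_pow]
    rw [ih] at key
    linear_combination g ^ 2 * key - (c' * a' - b' ^ 2) * hga -
      divisorSeries j * (a' + a * g) * hq

end IsPartSeries

/-! ### Pairs of partitions and the Durfee square -/

/-- The generating series of pairs of partitions with a weight. -/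
noncomputable def pairSeries (w : Multiset ℕ → Multiset ℕ → ℤ) : ℤ⟦X⟧ :=
  PowerSeries.mk fun n => ∑ p ∈ Finset.HasAntidiagonal.antidiagonal n,
    ∑ a ∈ partsFinset p.1, ∑ b ∈ partsFinset p.2, w a b

theorem genSeries_mul_genSeries (v w : Multiset ℕ → ℤ) :
    genSeries v * genSeries w = pairSeries fun a b => v a * w b := by
  ext n
  simp only [coeff_mul, genSeries, pairSeries, coeff_mk, Finset.sum_mul_sum]

theorem pairSeries_sq_sub (p q : Multiset ℕ → Prop) [DecidablePred p] [DecidablePred q]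
    (f g : Multiset ℕ → ℕ) :
    pairSeries (fun a b => if p a ∧ q b then ((f a : ℤ) - g b) ^ 2 else 0) =
      genSeries (fun a => if p a then (f a : ℤ) ^ 2 else 0) *
          genSeries (fun b => if q b then 1 else 0) -
        2 * (genSeries (fun a => if p a then (f a : ℤ) else 0) *
          genSeries fun b => if q b then (g b : ℤ) else 0) +
        genSeries (fun a => if p a then 1 else 0) *
          genSeries fun b => if q b then (g b : ℤ) ^ 2 else 0 := by
  simp only [genSeries_mul_genSeries]
  rw [two_mul]
  ext n
  simp only [map_add, map_sub, pairSeries, coeff_mk, ← Finset.sum_add_distrib,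
    ← Finset.sum_sub_distrib]
  refine Finset.sum_congr rfl fun s _ => Finset.sum_congr rfl fun a _ =>
    Finset.sum_congr rfl fun b _ => ?_
  by_cases hp : p a <;> by_cases hq : q b <;> simp [hp, hq]
  ring

/-- The Durfee square of a multiset of parts has size `j`. -/
def HasDurfee (j : ℕ) (m : Multiset ℕ) : Prop :=
  j ≤ Multiset.card (m.filter (j ≤ ·)) ∧ Multiset.card (m.filter (j < ·)) ≤ j

instance (j : ℕ) : DecidablePred (HasDurfee j) := fun _ =>
  inferInstanceAs (Decidable (_ ∧ _))

/-- Maximality need only be tested at j + 1: for k > j the parts ≥ k are among the parts > j. -/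
theorem durfee_eq_iff {n : ℕ} (π : n.Partition) (j : ℕ) :
    durfee π = j ↔ HasDurfee j π.parts := by
  rw [durfee, Nat.findGreatest_eq_iff, HasDurfee]
  constructor
  · rintro ⟨-, h2, h3⟩
    refine ⟨?_, ?_⟩
    · rcases Nat.eq_zero_or_pos j with rfl | hj
      · exact Nat.zero_le _
      · exact h2 hj.ne'
    · by_contra! h
      exact h3 j.lt_succ_self
        ((Nat.succ_le_of_lt h).trans (Multiset.card_le_card (Multiset.filter_le _ _))) h
  · rintro ⟨h1, h2⟩
    refine ⟨h1.trans (Multiset.card_le_card (Multiset.filter_le _ _)), fun _ => h1,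
      fun k hk _ hk' => ?_⟩
    have : Multiset.card (π.parts.filter (k ≤ ·)) ≤ Multiset.card (π.parts.filter (j < ·)) :=
      Multiset.card_le_card (Multiset.monotone_filter_right π.parts
        (fun i (hi : k ≤ i) => lt_of_lt_of_le hk hi))
    exact ((this.trans h2).trans_lt hk).not_ge hk'

theorem filter_lt_raise_add {j : ℕ} {a b : Multiset ℕ} (ha : ∀ i ∈ a, 0 < i)
    (hb : ∀ i ∈ b, i ≤ j) : (raise j j a + b).filter (j < ·) = a.map (· + j) := by
  rw [Multiset.filter_add, filter_lt_raise ha, Multiset.filter_eq_nil.2, add_zero]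
  exact fun i hi => (hb i hi).not_gt

theorem hasDurfee_raise_add {j : ℕ} {a b : Multiset ℕ} (ha : ∀ i ∈ a, 0 < i)
    (haj : Multiset.card a ≤ j) (hb : ∀ i ∈ b, i ≤ j) : HasDurfee j (raise j j a + b) := by
  refine ⟨?_, ?_⟩
  · rw [Multiset.filter_add, Multiset.filter_eq_self.2 fun i => le_of_mem_raise, Multiset.card_add,
      card_raise haj]
    exact Nat.le_add_right _ _
  · rwa [filter_lt_raise_add ha hb, Multiset.card_map]

/-- The parts below the Durfee square of size `j`. -/
def belowDurfee (j : ℕ) (m : Multiset ℕ) : Multiset ℕ :=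
  m.filter (¬ j < ·) - Multiset.replicate (j - Multiset.card (lower j m)) j

theorem raise_add_belowDurfee {j : ℕ} {m : Multiset ℕ} (h : HasDurfee j m) :
    raise j j (lower j m) + belowDurfee j m = m := by
  -- At least j parts are ≥ j, so enough parts equal to j exist to complete the rows of the square.
  have hle : Multiset.replicate (j - Multiset.card (lower j m)) j ≤ m.filter (¬ j < ·) := by
    rw [← Multiset.le_count_iff_replicate_le, Multiset.count_filter_of_pos (p := fun i => ¬ j < i) (lt_irrefl j),
      card_lower, ← Multiset.card_replicate (m.count j) j, ← Multiset.filter_eq',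
      Nat.sub_le_iff_le_add, ← Multiset.card_add]
    refine h.1.trans (Multiset.card_le_card (le_of_eq ?_))
    rw [Multiset.filter_add_filter, Multiset.filter_eq_nil (p := fun i => i = j ∧ j < i) |>.2
      fun i _ hi => by omega, add_zero]
    exact Multiset.filter_congr fun i _ => by omega
  rw [raise, map_add_lower, add_assoc, belowDurfee, add_tsub_cancel_of_le hle,
    Multiset.filter_add_not]

theorem belowDurfee_raise_add {j : ℕ} {a b : Multiset ℕ} (ha : ∀ i ∈ a, 0 < i)
    (hb : ∀ i ∈ b, i ≤ j) : belowDurfee j (raise j j a + b) = b := by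
  rw [belowDurfee, lower, filter_lt_raise_add ha hb, Multiset.filter_add, filter_not_lt_raise ha,
    Multiset.filter_eq_self.2 fun i hi => (hb i hi).not_gt, Multiset.card_map, Multiset.card_map,
    add_tsub_cancel_left]

theorem mem_belowDurfee {j i : ℕ} {m : Multiset ℕ} (h : i ∈ belowDurfee j m) :
    i ∈ m ∧ i ≤ j := by
  have := Multiset.mem_filter.1 (Multiset.mem_of_le (Multiset.sub_le_self _ _) h)
  exact ⟨this.1, not_lt.1 this.2⟩

/-- Durfee dissection: a lies to the right of the square and fixes the largest part, b lies below it
and fixes the number of parts. -/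
theorem genSeries_hasDurfee {j : ℕ} (hj : 0 < j) (h : ℕ → ℕ → ℤ) :
    genSeries (fun m => if HasDurfee j m then h m.sup (Multiset.card m) else 0) =
      X ^ (j * j) * pairSeries fun a b => if Multiset.card a ≤ j ∧ ∀ i ∈ b, i ≤ j then
        h (a.sup + j) (Multiset.card b + j) else 0 := by
  ext n
  have hsum : ∀ {m}, HasDurfee j m → (lower j m).sum + j * j + (belowDurfee j m).sum = m.sum := by
    intro m hm
    have hc : Multiset.card (lower j m) ≤ j := by rw [card_lower]; exact hm.2
    rw [← sum_raise hc, ← Multiset.sum_add, raise_add_belowDurfee hm]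
  rw [coeff_X_pow_mul', genSeries, pairSeries, coeff_mk, coeff_mk, ← Finset.sum_filter]
  split_ifs with hn
  · have e : ∀ p : ℕ × ℕ, (∑ a ∈ partsFinset p.1, ∑ b ∈ partsFinset p.2,
        if Multiset.card a ≤ j ∧ ∀ i ∈ b, i ≤ j then h (a.sup + j) (Multiset.card b + j) else 0) =
        ∑ x ∈ (partsFinset p.1 ×ˢ partsFinset p.2).filter
          (fun x => Multiset.card x.1 ≤ j ∧ ∀ i ∈ x.2, i ≤ j),
          h (x.1.sup + j) (Multiset.card x.2 + j) := by
      intro p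
      rw [Finset.sum_filter, Finset.sum_product]
    rw [Finset.sum_congr rfl fun p _ => e p, Finset.sum_sigma']
    refine Finset.sum_bij' (fun m _ => (⟨((lower j m).sum, (belowDurfee j m).sum),
        (lower j m, belowDurfee j m)⟩ : Σ _ : ℕ × ℕ, Multiset ℕ × Multiset ℕ))
      (fun v _ => raise j j v.2.1 + v.2.2) ?_ ?_ ?_ ?_ ?_
    · intro m hm
      simp only [Finset.mem_filter, mem_partsFinset] at hm
      have := hsum hm.2
      simp only [Finset.mem_sigma, Finset.HasAntidiagonal.mem_antidiagonal, Finset.mem_filter,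
        Finset.mem_product, mem_partsFinset, true_and]
      refine ⟨by omega, ⟨fun i => pos_of_mem_lower, fun i hi => hm.1.2 i (mem_belowDurfee hi).1⟩,
        ?_, fun i hi => (mem_belowDurfee hi).2⟩
      rw [card_lower]
      exact hm.2.2
    · rintro ⟨⟨s, t⟩, a, b⟩ hv
      simp only [Finset.mem_sigma, Finset.HasAntidiagonal.mem_antidiagonal, Finset.mem_filter,
        Finset.mem_product, mem_partsFinset] at hv
      obtain ⟨hst, ⟨⟨ha, ha'⟩, hb, hb'⟩, hac, hbj⟩ := hv
      simp only [Finset.mem_filter, mem_partsFinset]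
      refine ⟨⟨?_, ?_⟩, hasDurfee_raise_add ha' hac hbj⟩
      · rw [Multiset.sum_add, sum_raise hac]
        omega
      · intro i hi
        exact (Multiset.mem_add.1 hi).elim (fun hi => hj.trans_le (le_of_mem_raise hi)) (hb' i)
    · intro m hm
      exact raise_add_belowDurfee (Finset.mem_filter.1 hm).2
    · rintro ⟨⟨s, t⟩, a, b⟩ hv
      simp only [Finset.mem_sigma, Finset.HasAntidiagonal.mem_antidiagonal, Finset.mem_filter,
        Finset.mem_product, mem_partsFinset] at hv
      obtain ⟨-, ⟨⟨rfl, ha'⟩, rfl, -⟩, -, hbj⟩ := hv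
      have e1 : lower j (raise j j a + b) = a := by
        rw [lower, filter_lt_raise_add ha' hbj]
        simp
      simp only [e1, belowDurfee_raise_add ha' hbj]
    · intro m hm
      have hd := (Finset.mem_filter.1 hm).2
      have hc : Multiset.card (lower j m) ≤ j := by rw [card_lower]; exact hd.2
      have hm' := raise_add_belowDurfee hd
      have h1 : m.sup = (lower j m).sup + j := by
        rw [← sup_raise hj hc]
        conv_lhs => rw [← hm', Multiset.sup_add]
        refine sup_eq_left.2 (Multiset.sup_le.2 fun i hi => ?_)
        rw [sup_raise hj hc]
        exact (mem_belowDurfee hi).2.trans (Nat.le_add_left _ _)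
      have h2 : Multiset.card m = Multiset.card (belowDurfee j m) + j := by
        conv_lhs => rw [← hm', Multiset.card_add, card_raise hc, add_comm]
      rw [← h1, ← h2]
  · refine Finset.sum_eq_zero fun m hm => ?_
    simp only [Finset.mem_filter, mem_partsFinset] at hm
    have := hsum hm.2
    omega

/-- The difference of two independent copies has twice the variance. -/
theorem pairSeries_bounded (j : ℕ) :
    pairSeries (fun a b => if (∀ i ∈ a, i ≤ j) ∧ ∀ i ∈ b, i ≤ j then
      ((Multiset.card a : ℤ) - Multiset.card b) ^ 2 else 0) =
      2 * (qFactorialInv j ^ 2 * divisorSeries j) := by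
  have h := isPartSeries_boundedSeries.variance_eq j
  refine (pairSeries_sq_sub _ _ _ _).trans ?_
  change boundedSeries j (fun x => (x : ℤ) ^ 2) * boundedSeries j (fun _ => 1) -
    2 * (boundedSeries j (fun x => x) * boundedSeries j fun x => x) +
    boundedSeries j (fun _ => 1) * boundedSeries j (fun x => (x : ℤ) ^ 2) = _
  linear_combination 2 * h

/-- The side j cancels in the rank, and the two remaining statistics have equal moments up to order
two. -/
theorem genSeries_rank_sq {j : ℕ} (hj : 0 < j) :
    genSeries (fun m => if HasDurfee j m then ((m.sup : ℤ) - Multiset.card m) ^ 2 else 0) =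
      X ^ (j * j) * (2 * (qFactorialInv j ^ 2 * divisorSeries j)) := by
  rw [genSeries_hasDurfee hj fun x y => ((x : ℤ) - y) ^ 2]
  congr 1
  have h := isPartSeries_boundedSeries.variance_eq j
  simp only [Nat.cast_add, add_sub_add_right_eq_sub]
  refine (pairSeries_sq_sub _ _ _ _).trans ?_
  change shortSeries j (fun x => (x : ℤ) ^ 2) * boundedSeries j (fun _ => 1) -
    2 * (shortSeries j (fun x => x) * boundedSeries j fun x => x) +
    shortSeries j (fun _ => 1) * boundedSeries j (fun x => (x : ℤ) ^ 2) = _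
  rw [isPartSeries_shortSeries.zeroth_eq, isPartSeries_shortSeries.first_eq
    isPartSeries_boundedSeries, isPartSeries_shortSeries.second_eq isPartSeries_boundedSeries]
  rw [isPartSeries_boundedSeries.zeroth_eq] at h ⊢
  linear_combination 2 * h

/-! ### Signed partitions into distinct parts -/

/-- Partitions into distinct parts from `s`, weighted by the sign of the number of parts. -/
noncomputable def signedSeries (s : Finset ℕ) : ℤ⟦X⟧ :=
  genSeries fun m => if m.Nodup ∧ ∀ i ∈ m, i ∈ s then (-1) ^ Multiset.card m else 0

/-- Adjoining k to s adds the partitions containing k; deleting that part flips the sign and lowers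
the size by k. -/
theorem signedSeries_eq_prod (s : Finset ℕ) (hs : 0 ∉ s) :
    signedSeries s = ∏ k ∈ s, (1 - X ^ k) := by
  induction s using Finset.induction_on with
  | empty =>
    rw [signedSeries, genSeries_eq_C]
    · simp
    · intro m _ hm0
      obtain ⟨i, hi⟩ := Multiset.exists_mem_of_ne_zero hm0
      exact if_neg fun h => absurd (h.2 i hi) (Finset.notMem_empty i)
  | insert k s hk ih =>
    rw [Finset.mem_insert, not_or] at hs
    rw [Finset.prod_insert hk, ← ih hs.2]
    have h := genSeries_eq_X_pow_mul k
      (fun m => (m.Nodup ∧ ∀ i ∈ m, i ∈ insert k s) ∧ k ∈ m)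
      (fun m => m.Nodup ∧ ∀ i ∈ m, i ∈ s) (fun m => m.erase k) (fun m => k ::ₘ m)
      (fun m hm hp => ⟨⟨hp.1.1.erase k, fun i hi => by
          rw [hp.1.1.mem_erase_iff] at hi
          exact (Finset.mem_insert.1 (hp.1.2 i hi.2)).resolve_left hi.1⟩,
        fun i hi => hm i (Multiset.mem_of_mem_erase hi),
        by rw [add_comm, Multiset.sum_erase hp.2], Multiset.cons_erase hp.2⟩)
      (fun m hm hq => ⟨⟨⟨Multiset.nodup_cons.2 ⟨fun h => hk (hq.2 k h), hq.1⟩, fun i hi =>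
            (Multiset.mem_cons.1 hi).elim (fun h => h ▸ Finset.mem_insert_self _ _)
              fun h => Finset.mem_insert_of_mem (hq.2 i h)⟩, Multiset.mem_cons_self _ _⟩,
        fun i hi => (Multiset.mem_cons.1 hi).elim
          (fun h => h ▸ Nat.pos_of_ne_zero (Ne.symm hs.1)) (hm i),
        by rw [Multiset.sum_cons, add_comm], Multiset.erase_cons_head _ _⟩)
      (fun m => (-1) ^ Multiset.card m)
    have h' : genSeries (fun m => if m.Nodup ∧ ∀ i ∈ m, i ∈ s then
        (-1) ^ Multiset.card (k ::ₘ m) else 0) = -signedSeries s := by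
      rw [signedSeries, ← genSeries_neg]
      refine genSeries_congr fun m _ => ?_
      split_ifs <;> simp [pow_succ]
    rw [h'] at h
    rw [sub_mul, one_mul, sub_eq_add_neg, ← mul_neg, ← h, signedSeries, signedSeries,
      ← genSeries_add]
    refine genSeries_congr fun m _ => ?_
    by_cases hkm : k ∈ m
    · have : ¬ ∀ i ∈ m, i ∈ s := fun h => hk (h k hkm)
      simp [hkm, this]
    · have : (∀ i ∈ m, i ∈ insert k s) ↔ ∀ i ∈ m, i ∈ s := by
        refine forall₂_congr fun i hi => ?_
        have : i ≠ k := fun h => hkm (h ▸ hi)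
        simp [this]
      simp only [hkm, this, and_false, if_false, add_zero]

theorem qFactorial_mul_signedSeries (i j : ℕ) :
    qFactorial i * signedSeries (Finset.Icc (i + 1) (i + j)) = qFactorial (i + j) := by
  rw [signedSeries_eq_prod _ (by simp)]
  induction j with
  | zero => simp
  | succ j ih =>
    rw [← add_assoc, Finset.prod_Icc_succ_top (by omega), ← mul_assoc, ih, qFactorial_succ]

theorem signedSeries_Icc_one (n : ℕ) : signedSeries (Finset.Icc 1 n) = qFactorial n := by
  simpa [qFactorial] using qFactorial_mul_signedSeries 0 n

/-- This absorbs the signs of π₁: the left side is (q)_N / ((q)_{N-j} (q)_j), and the Gaussian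
binomial has nonnegative coefficients. -/
theorem signedSeries_mul_qFactorialInv {N j : ℕ} (h : j ≤ N) :
    signedSeries (Finset.Icc (N - j + 1) N) * qFactorialInv j = gaussBinom N j := by
  obtain ⟨i, rfl⟩ := Nat.exists_eq_add_of_le' h
  rw [Nat.add_sub_cancel]
  have h1 := qFactorial_mul_signedSeries i j
  have h2 := gaussBinom_mul_qFactorial i j
  have h3 := qFactorial_mul_inv i
  have h4 := qFactorial_mul_inv j
  generalize signedSeries (Finset.Icc (i + 1) (i + j)) = S at *
  linear_combination qFactorialInv i * qFactorialInv j * (h1 - h2) - S * qFactorialInv j * h3 +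
    gaussBinom (i + j) j * (qFactorial j * qFactorialInv j * h3 + h4)

/-! ### The moments as coefficients -/

theorem finsum_mul_sum_fiber {ι : Type*} (V : Finset ι) (r : ι → ℤ) (f : ℤ → ℤ) (s : ι → ℤ) :
    ∑ᶠ m : ℤ, f m * ∑ v ∈ V.filter (fun v => r v = m), s v = ∑ v ∈ V, s v * f (r v) := by
  rw [finsum_eq_sum_of_support_subset (s := V.image r)]
  · rw [← Finset.sum_fiberwise_of_maps_to (g := r) (t := V.image r)
      (fun v hv => Finset.mem_image_of_mem r hv)]
    refine Finset.sum_congr rfl fun m _ => ?_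
    rw [Finset.mul_sum]
    refine Finset.sum_congr rfl fun v hv => ?_
    rw [(Finset.mem_filter.1 hv).2, mul_comm]
  · intro m hm
    obtain ⟨v, hv, -⟩ := Finset.exists_ne_zero_of_sum_ne_zero (right_ne_zero_of_mul hm)
    rw [Finset.mem_filter] at hv
    exact Finset.mem_coe.2 (Finset.mem_image.2 ⟨v, hv⟩)

theorem finsum_rankCountDurfee (N j n : ℕ) :
    ∑ᶠ m : ℤ, m ^ 2 * rankCountDurfee N j m n =
      coeff n (signedSeries (Finset.Icc (N - j + 1) N) *
        genSeries fun m => if HasDurfee j m then ((m.sup : ℤ) - Multiset.card m) ^ 2 else 0) := by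
  simp only [rankCountDurfee]
  refine (finsum_mul_sum_fiber (rankVectors N j n) (fun v => rank v.2.2) (fun m => m ^ 2)
    fun v => (-1) ^ numParts v.2.1).trans ?_
  rw [rankVectors, Finset.sum_sigma, signedSeries, coeff_mul]
  refine Finset.sum_congr rfl fun s _ => ?_
  rw [Finset.sum_product, genSeries, genSeries, coeff_mk, coeff_mk, ← sum_partition_eq,
    ← sum_partition_eq, Finset.sum_mul_sum, Nat.Partition.distincts, Finset.filter_filter,
    Finset.sum_filter]
  refine Finset.sum_congr rfl fun π₁ _ => ?_
  simp only [Finset.mem_Icc, Finset.sum_filter, durfee_eq_iff]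
  split_ifs with h
  · refine Finset.sum_congr rfl fun π₂ _ => ?_
    rw [mul_ite, mul_zero]
    rfl
  · simp

theorem crankMoment_two_eq (N n : ℕ) :
    crankMoment 2 N n = coeff n (signedSeries (Finset.Icc 1 N) *
      pairSeries fun a b => if (∀ i ∈ a, i ≤ N) ∧ ∀ i ∈ b, i ≤ N then
        ((Multiset.card a : ℤ) - Multiset.card b) ^ 2 else 0) := by
  simp only [crankMoment, crankCount]
  refine (finsum_mul_sum_fiber (crankVectors N n)
    (fun v => (numParts v.2.2.2.1 : ℤ) - (numParts v.2.2.2.2 : ℤ)) (fun m => m ^ 2)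
    fun v => (-1) ^ numParts v.2.1).trans ?_
  rw [crankVectors, Finset.sum_sigma, signedSeries, coeff_mul]
  refine Finset.sum_congr rfl fun s _ => ?_
  rw [Finset.sum_product, genSeries, coeff_mk, ← sum_partition_eq, Finset.sum_mul,
    Nat.Partition.distincts, Finset.filter_filter, Finset.sum_filter]
  refine Finset.sum_congr rfl fun π₁ _ => ?_
  have hmem : (∀ i ∈ π₁.parts, i ∈ Finset.Icc 1 N) ↔ largestPart π₁ ≤ N := by
    rw [largestPart, Multiset.sup_le]
    refine forall₂_congr fun i hi => ?_
    rw [Finset.mem_Icc]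
    exact and_iff_right (π₁.parts_pos hi)
  rw [ite_mul, zero_mul]
  refine if_congr (and_congr_right' hmem.symm) ?_ rfl
  rw [pairSeries, coeff_mk, Finset.sum_sigma, Finset.mul_sum]
  refine Finset.sum_congr rfl fun t _ => ?_
  rw [Finset.sum_product, ← sum_partition_eq (n := t.1)
    (fun a => ∑ b ∈ partsFinset t.2, _), Finset.sum_filter, Finset.mul_sum]
  refine Finset.sum_congr rfl fun π₂ _ => ?_
  rw [← sum_partition_eq, Finset.sum_filter, Finset.mul_sum]
  simp only [largestPart, Multiset.sup_le]
  split_ifs with h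
  · refine Finset.sum_congr rfl fun π₃ _ => ?_
    rw [mul_ite, mul_zero]
    exact if_congr (and_iff_right h).symm rfl rfl
  · simp [h]

theorem rankMoment_two_eq (N n : ℕ) :
    rankMoment 2 N n = 2 * coeff n (∑ j ∈ Finset.range (N + 1),
      gaussBinom N j * X ^ (j * j) * qFactorialInv j * divisorSeries j) := by
  simp only [rankMoment, rankCount, Finset.mul_sum]
  rw [finsum_sum_comm, Finset.sum_congr rfl fun j _ => finsum_rankCountDurfee N j n, map_sum,
    Finset.mul_sum, ← Finset.sum_subset (s₁ := Finset.Icc 1 N) (s₂ := Finset.range (N + 1))]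
  · refine Finset.sum_congr rfl fun j hj => ?_
    rw [Finset.mem_Icc] at hj
    rw [genSeries_rank_sq hj.1, ← signedSeries_mul_qFactorialInv hj.2, two_mul, two_mul, ← map_add]
    congr 1
    ring
  · intro j hj
    rw [Finset.mem_Icc] at hj
    exact Finset.mem_range.2 (by omega)
  -- The index j = 0, absent from the moment but needed for the Vandermonde sum, contributes nothing
  -- because D_0 = 0.
  · intro j hj hj'
    rw [Finset.mem_range] at hj
    rw [Finset.mem_Icc] at hj'
    obtain rfl : j = 0 := by omega
    simp [divisorSeries]
  · intro j _
    refine Set.Finite.subset (Finset.finite_toSet ((rankVectors N j n).image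
      fun v => rank v.2.2)) fun m hm => ?_
    obtain ⟨v, hv, -⟩ := Finset.exists_ne_zero_of_sum_ne_zero (right_ne_zero_of_mul hm)
    rw [Finset.mem_filter] at hv
    exact Finset.mem_coe.2 (Finset.mem_image.2 ⟨v, hv⟩)

end FiniteMoments

theorem mainTheorem7 (N : ℕ) (hN : 1 ≤ N) (n : ℕ) (hn : 1 ≤ n) :
    FiniteMoments.crankMoment 2 N n > FiniteMoments.rankMoment 2 N n := by
  open FiniteMoments PowerSeries in
  have h : crankMoment 2 N n = 2 * coeff n (qFactorialInv N * divisorSeries N) := by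
    rw [crankMoment_two_eq, signedSeries_Icc_one, pairSeries_bounded, two_mul, two_mul, ← map_add]
    congr 1
    -- The signed factor (q)_N cancels one of the two factors 1/(q)_N.
    linear_combination 2 * qFactorialInv N * divisorSeries N * qFactorial_mul_inv N
  rw [h, FiniteMoments.rankMoment_two_eq]
  have := FiniteMoments.coeff_rank_lt_crank hN hn
  linarith
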